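/- **Language.** Let $\mathcal L$ be a first-order language with countably many constants, function symbols and predicate symbols, among them a unary "existence predicate" $E$, with $\top,\bot,\land,\lor,\to,\neg,\forall,\exists$. Put $\sim\! A := A\to\bot$. Let $\mathcal L^{-\neg E}$ be the fragment without $\neg$ and $E$. *Global negative* (GN) formulas are $N ::= \bot \mid \neg A \mid N\land N\mid N\lor N\mid N\to N\mid \forall xN\mid\exists xN$, where $A$ is any formula and, in $\forall xN$, $\exists xN$, $x$ is free in $N$. A quantification $QxA$ is *global* if $x$ occurs free in $A$ and every free occurrence of it in $A$ lies in a GN subformula of $A$; otherwise (in particular if it is vacuous) it is *local*. **Models.** A strict finitistic model $W=\langle K,\le,D,J,v\rangle$ is a rooted tree-like partial order $K$ with at most countable branchings and height at most $\omega$, a non-empty constant domain $D$, an interpretation $J$ of the constants and function symbols in $D$ (names of elements of $D$ denote those elements), and for every $k\in K$ and predicate $P$ an extension $P^{v(k)}$, monotone in $k$, such that (strictness) $\langle J(c_1),\dots,J(c_n)\rangle\in P^{v(k)}$ implies $J(c')\in E^{v(k)}$ for every subterm $c'$ of a $c_i$ ($c_1,\dots,c_n$ closed terms with names), and (finite verification)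 $\{P\mid P^{v(k)}\ne\emptyset\}$ is finite for all $k$. The relation $k\models A$ is defined as usual for atoms, $\top,\bot,\land,\lor$, and - $k\models A\to B$ iff for all $k'\ge k$ with $k'\models A$ there is $k''\ge k'$ with $k''\models B$; $k\models\neg A$ iff $l\not\models A$ for all $l\in K$; - $k\models\forall xA$ iff for all $d\in D$: $k\models\top\to A[\overline d/x]$ (global), $k\models E(\overline d)\to A[\overline d/x]$ (local); - $k\models\exists xA$ iff for some $d\in D$: $k\models A[\overline d/x]$ (global), $k\models E(\overline d)\land A[\overline d/x]$ (local). The intuitionistic relation $k\Vdash A$, for $A$ in $\mathcal L^{-\neg E}$, is defined in the same models with the same clauses for atoms, $\top,\bot,\land,\lor$, and: $k\Vdash A\to B$ iff every $k'\ge k$ with $k'\Vdash A$ has $k'\Vdash B$; $k\Vdash\forall xA$ iff $k'\Vdash A[\overline d/x]$ for all $k'\ge k$ and $d\in D$; $k\Vdash\exists xA$ iff $k\Vdash A[\overline d/x]$ for some $d\in D$. A formula is valid in $W$ (in either sense) if its universal closure is forced at all nodes. $W$ is *prevalent* if every closed formula (with names) forced at some node is forced at some $k'\ge k$ for every $k$,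 and for all $d\in D$, $k\in K$ there is $k'\ge k$ with $k'\models E(\overline d)$. Let $\mathcal W_{\mathrm P2}$ be the class of prevalent models with exactly two nodes. **Logics.** $\mathbf{HTCD}$ is the set of closed formulas of $\mathcal L^{-\neg E}$ derivable in intuitionistic first-order logic $\mathbf{IQC}$ from the universal closures of all $A\lor(A\to B)\lor\sim\! B$ and of all $\forall x(C\lor A)\to C\lor\forall xA$ with $x$ not free in $C$. Let $\mathrm{ST}$ be given by $S::=\top\mid N\mid S\land S\mid S\lor N\mid N\lor S\mid A\to B\mid\forall xA$ ($N$ GN; $A,B$ any formulas), and $\mathrm{ST_P}$ by $S' ::= S\mid S'\lor S'\mid\exists xS'$ with $S\in\mathrm{ST}$ and $\exists xS'$ global. $\mathbf{NSF_P}$ is the natural deduction system for $\mathcal L$ with the usual rules for $\top$, $\bot$, $\land$, $\lor$ and the following: from $P(t_1,\dots,t_n)$ infer $E(t_i)$; from $E(f(t_1,\dots,t_n))$ infer $E(t_i)$; from $\sim\sim\! S$ infer $S$ for $S\in\mathrm{ST_P}$; from a derivation of $\sim\sim\! B$ from $A$ infer $A\to B$, discharging $A$; from $A\to B$ and $A$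 infer $\sim\sim\! B$; from $\sim\! A$ infer $\neg A$; from $\neg A$ and $A$ infer $\bot$; axioms $\neg\neg A\to A$ and $\forall x\neg\neg E(x)$; from $\sim\sim\! A$ infer $\forall xA$ ($x$ not free in the open hypotheses); from $\forall xA$ infer $\sim\sim\! A[t/x]$; for global $\exists xA$ the usual rules for $\exists$; for local $\exists xA$ the introduction rule with the additional premise $E(t)$ and the elimination rule with the additional dischargeable hypothesis $E(x)$. $\mathbf{SFQ}_{\mathbf P}^{-\neg E}$ is the set of closed formulas of $\mathcal L^{-\neg E}$ derivable in $\mathbf{NSF_P}$ without open hypotheses. **Translation.** For $A$ in $\mathcal L^{-\neg E}$, $A^\star$ is defined by $P^\star=P$ for atoms ($\top,\bot$ included), $(A\mathbin\square B)^\star=A^\star\mathbin\square B^\star$ for $\square\in\{\land,\lor,\to\}$, $(\forall xA)^\star=\forall x(A^\star)$, $(\exists xA)^\star=\;\sim\sim\!\exists x(A^\star)$. **Proposition.** (i) For every formula $A$ of $\mathcal L^{-\neg E}$: if $A$ is intuitionistically valid ($\Vdash$) in all $W\in\mathcal W_{\mathrm P2}$, then $A^\star$ is strict-finitistically valid ($\models$)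 in all $W\in\mathcal W_{\mathrm P2}$. (ii) $A^\star\in\mathbf{SFQ}_{\mathbf P}^{-\neg E}$ for every $A\in\mathbf{HTCD}$; that is, $[\mathbf{HTCD}]^\star\subseteq\mathbf{SFQ}_{\mathbf P}^{-\neg E}$. -/

import Mathlib

universe u

namespace SFQ

/-! ## Terms

The function symbols (constants are the nullary ones) and the predicate symbols other than the
existence predicate are those of a `FirstOrder.Language`. Variables are de Bruijn indices: in the
scope of a quantifier, `0` is the variable bound by it and `i + 1` is the variable `i` outside. -/

/-- Terms with variables `0, 1, 2, …`. -/
abbrev Tm (L : FirstOrder.Language.{0, 0}) : Type := L.Term ℕ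

/-- The substitution `σ` under a quantifier. -/
def up {L : FirstOrder.Language.{0, 0}} (σ : ℕ → Tm L) : ℕ → Tm L
  | 0 => FirstOrder.Language.Term.var 0
  | i + 1 => (σ i).relabel Nat.succ

/-- The substitution of `t` for the variable `0`, which also lowers the other variables by one. -/
def single {L : FirstOrder.Language.{0, 0}} (t : Tm L) : ℕ → Tm L
  | 0 => t
  | i + 1 => FirstOrder.Language.Term.var i

/-- The renaming of every variable `i` to `i + 1`. -/
def succVar {L : FirstOrder.Language.{0, 0}} : ℕ → Tm L := fun i => FirstOrder.Language.Term.var (i + 1)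

/-- `Subterm s t`: `s` is a subterm of `t` (possibly `t` itself). -/
inductive Subterm {L : FirstOrder.Language.{0, 0}} {α : Type u} : L.Term α → L.Term α → Prop
  | refl (t : L.Term α) : Subterm t t
  | func {n : ℕ} (f : L.Functions n) (ts : Fin n → L.Term α) (i : Fin n) (s : L.Term α) :
      Subterm s (ts i) → Subterm s (FirstOrder.Language.Term.func f ts)

/-! ## The full language: existence predicate `E` and strict finitistic negation `neg` -/

/-- The formulas of the full language. -/
inductive Form (L : FirstOrder.Language.{0, 0}) : Type
  | rel {n : ℕ} (R : L.Relations n) (ts : Fin n → Tm L) : Form L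
  | E (t : Tm L) : Form L
  | top : Form L
  | bot : Form L
  | and (A B : Form L) : Form L
  | or (A B : Form L) : Form L
  | imp (A B : Form L) : Form L
  | neg (A : Form L) : Form L
  | all (A : Form L) : Form L
  | ex (A : Form L) : Form L

namespace Form

variable {L : FirstOrder.Language.{0, 0}}

/-- The defined negation `A → ⊥`. -/
def wneg (A : Form L) : Form L := imp A bot

/-- Simultaneous capture-avoiding substitution. -/
def subst : Form L → (ℕ → Tm L) → Form L
  | rel R ts, σ => rel R (fun i => (ts i).subst σ)
  | E t, σ => E (t.subst σ)
  | top, _ => top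
  | bot, _ => bot
  | and A B, σ => and (A.subst σ) (B.subst σ)
  | or A B, σ => or (A.subst σ) (B.subst σ)
  | imp A B, σ => imp (A.subst σ) (B.subst σ)
  | neg A, σ => neg (A.subst σ)
  | all A, σ => all (A.subst (up σ))
  | ex A, σ => ex (A.subst (up σ))

/-- The instance of the body `A` of a quantifier at the term `t`. -/
def inst (A : Form L) (t : Tm L) : Form L := A.subst (single t)

/-- `A`, viewed in the scope of one more quantifier (which does not bind anything in it). -/
def shift (A : Form L) : Form L := A.subst succVar

/-- The set of the free variables. -/
def fv : Form L → Finset ℕ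
  | rel _ ts => Finset.univ.biUnion (fun i => (ts i).varFinset)
  | E t => t.varFinset
  | top => ∅
  | bot => ∅
  | and A B => A.fv ∪ B.fv
  | or A B => A.fv ∪ B.fv
  | imp A B => A.fv ∪ B.fv
  | neg A => A.fv
  | all A => (A.fv.erase 0).image Nat.pred
  | ex A => (A.fv.erase 0).image Nat.pred

/-- `n` universal quantifiers in front. -/
def alls : ℕ → Form L → Form L
  | 0, A => A
  | n + 1, A => all (alls n A)

/-- The universal closure: exactly the free variables are bound, in the order of their indices
(the least one outermost; so a free variable `i` turns into the de Bruijn index that is the number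
of free variables greater than `i`). -/
def closure (A : Form L) : Form L :=
  alls A.fv.card (A.subst (fun i => FirstOrder.Language.Term.var (A.fv.filter (fun j => i < j)).card))

/-- The global negative formulas: those built from `⊥` and the formulas `¬ A` by `∧`, `∨`, `→` and
non-vacuous quantification. Vacuous quantification is local, so that a vacuously quantified formula
such as `∃ x ¬ ⊥` can be forced at one node and fail at another. -/
def GN : Form L → Prop
  | rel _ _ => False
  | E _ => False
  | top => False
  | bot => True
  | and A B => A.GN ∧ B.GN
  | or A B => A.GN ∧ B.GN
  | imp A B => A.GN ∧ B.GN
  | neg _ => True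
  | all A => 0 ∈ A.fv ∧ A.GN
  | ex A => 0 ∈ A.fv ∧ A.GN

/-- The variable `i` has a free occurrence in the formula that lies in no global negative
subformula. -/
def OccursOutsideGN : Form L → ℕ → Prop
  | rel _ ts, i => ∃ j, i ∈ (ts j).varFinset
  | E t, i => i ∈ t.varFinset
  | top, _ => False
  | bot, _ => False
  | and A B, i => ¬ (and A B).GN ∧ (A.OccursOutsideGN i ∨ B.OccursOutsideGN i)
  | or A B, i => ¬ (or A B).GN ∧ (A.OccursOutsideGN i ∨ B.OccursOutsideGN i)
  | imp A B, i => ¬ (imp A B).GN ∧ (A.OccursOutsideGN i ∨ B.OccursOutsideGN i)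
  | neg _, _ => False
  | all A, i => ¬ (all A).GN ∧ A.OccursOutsideGN (i + 1)
  | ex A, i => ¬ (ex A).GN ∧ A.OccursOutsideGN (i + 1)

/-- The variable `0` occurs in `A`, and only globally; then the quantifications `all A` and `ex A`
are global. Otherwise (in particular if `0` does not occur in `A`) they are local. -/
def GlobalOnly (A : Form L) : Prop := 0 ∈ A.fv ∧ ¬ A.OccursOutsideGN 0

/-- The class `ST` of formulas. -/
inductive ST : Form L → Prop
  | top : ST top
  | gn (N : Form L) : N.GN → ST N
  | and (S T : Form L) : ST S → ST T → ST (and S T)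
  | or_left (S N : Form L) : ST S → N.GN → ST (or S N)
  | or_right (N S : Form L) : N.GN → ST S → ST (or N S)
  | imp (A B : Form L) : ST (imp A B)
  | all (A : Form L) : ST (all A)

/-- The class `ST_P` of formulas. -/
inductive STP : Form L → Prop
  | st (S : Form L) : ST S → STP S
  | or (S T : Form L) : STP S → STP T → STP (or S T)
  | ex (S : Form L) : S.GlobalOnly → STP S → STP (ex S)

end Form

/-- Derivability `Γ ⊢ A` in the natural deduction system `NSF_P`. -/
inductive NSFP {L : FirstOrder.Language.{0, 0}} : Set (Form L) → Form L → Prop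
  | ax {Γ : Set (Form L)} {A : Form L} : A ∈ Γ → NSFP Γ A
  | topI {Γ : Set (Form L)} : NSFP Γ Form.top
  | botE {Γ : Set (Form L)} {A : Form L} : NSFP Γ Form.bot → NSFP Γ A
  | andI {Γ : Set (Form L)} {A B : Form L} : NSFP Γ A → NSFP Γ B → NSFP Γ (Form.and A B)
  | andE₁ {Γ : Set (Form L)} {A B : Form L} : NSFP Γ (Form.and A B) → NSFP Γ A
  | andE₂ {Γ : Set (Form L)} {A B : Form L} : NSFP Γ (Form.and A B) → NSFP Γ B
  | orI₁ {Γ : Set (Form L)} {A B : Form L} : NSFP Γ A → NSFP Γ (Form.or A B)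
  | orI₂ {Γ : Set (Form L)} {A B : Form L} : NSFP Γ B → NSFP Γ (Form.or A B)
  | orE {Γ : Set (Form L)} {A B C : Form L} : NSFP Γ (Form.or A B) →
      NSFP (insert A Γ) C → NSFP (insert B Γ) C → NSFP Γ C
  | str₁ {Γ : Set (Form L)} {n : ℕ} {R : L.Relations n} {ts : Fin n → Tm L} (i : Fin n) :
      NSFP Γ (Form.rel R ts) → NSFP Γ (Form.E (ts i))
  | str₂ {Γ : Set (Form L)} {n : ℕ} {f : L.Functions n} {ts : Fin n → Tm L} (i : Fin n) :
      NSFP Γ (Form.E (FirstOrder.Language.Term.func f ts)) → NSFP Γ (Form.E (ts i))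
  | stP {Γ : Set (Form L)} {S : Form L} : S.STP → NSFP Γ S.wneg.wneg → NSFP Γ S
  | impI {Γ : Set (Form L)} {A B : Form L} :
      NSFP (insert A Γ) B.wneg.wneg → NSFP Γ (Form.imp A B)
  | impE {Γ : Set (Form L)} {A B : Form L} :
      NSFP Γ (Form.imp A B) → NSFP Γ A → NSFP Γ B.wneg.wneg
  | negIP {Γ : Set (Form L)} {A : Form L} : NSFP Γ A.wneg → NSFP Γ (Form.neg A)
  | negE {Γ : Set (Form L)} {A : Form L} : NSFP Γ (Form.neg A) → NSFP Γ A → NSFP Γ Form.bot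
  | dne {Γ : Set (Form L)} {A : Form L} : NSFP Γ (Form.imp (Form.neg (Form.neg A)) A)
  | obj {Γ : Set (Form L)} :
      NSFP Γ (Form.all (Form.neg (Form.neg (Form.E (FirstOrder.Language.Term.var 0)))))
  | allIP {Γ : Set (Form L)} {A : Form L} :
      NSFP (Form.shift '' Γ) A.wneg.wneg → NSFP Γ (Form.all A)
  | allEP {Γ : Set (Form L)} {A : Form L} (t : Tm L) :
      NSFP Γ (Form.all A) → NSFP Γ (A.inst t).wneg.wneg
  | exGloI {Γ : Set (Form L)} {A : Form L} (t : Tm L) : A.GlobalOnly →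
      NSFP Γ (A.inst t) → NSFP Γ (Form.ex A)
  | exLocI {Γ : Set (Form L)} {A : Form L} (t : Tm L) : ¬ A.GlobalOnly →
      NSFP Γ (A.inst t) → NSFP Γ (Form.E t) → NSFP Γ (Form.ex A)
  | exGloE {Γ : Set (Form L)} {A C : Form L} : A.GlobalOnly → NSFP Γ (Form.ex A) →
      NSFP (insert A (Form.shift '' Γ)) C.shift → NSFP Γ C
  | exLocE {Γ : Set (Form L)} {A C : Form L} : ¬ A.GlobalOnly → NSFP Γ (Form.ex A) →
      NSFP (insert A (insert (Form.E (FirstOrder.Language.Term.var 0)) (Form.shift '' Γ))) C.shift →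
      NSFP Γ C

/-! ## The fragment without `neg` and `E`: the language of the intermediate logics -/

/-- The formulas of the fragment without `neg` and `E`. -/
inductive IForm (L : FirstOrder.Language.{0, 0}) : Type
  | rel {n : ℕ} (R : L.Relations n) (ts : Fin n → Tm L) : IForm L
  | top : IForm L
  | bot : IForm L
  | and (A B : IForm L) : IForm L
  | or (A B : IForm L) : IForm L
  | imp (A B : IForm L) : IForm L
  | all (A : IForm L) : IForm L
  | ex (A : IForm L) : IForm L

namespace IForm

variable {L : FirstOrder.Language.{0, 0}}

/-- The inclusion of the fragment in the full language. -/
def toForm : IForm L → Form L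
  | rel R ts => Form.rel R ts
  | top => Form.top
  | bot => Form.bot
  | and A B => Form.and A.toForm B.toForm
  | or A B => Form.or A.toForm B.toForm
  | imp A B => Form.imp A.toForm B.toForm
  | all A => Form.all A.toForm
  | ex A => Form.ex A.toForm

/-- The defined negation `A → ⊥`. -/
def wneg (A : IForm L) : IForm L := imp A bot

/-- Simultaneous capture-avoiding substitution. -/
def subst : IForm L → (ℕ → Tm L) → IForm L
  | rel R ts, σ => rel R (fun i => (ts i).subst σ)
  | top, _ => top
  | bot, _ => bot
  | and A B, σ => and (A.subst σ) (B.subst σ)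
  | or A B, σ => or (A.subst σ) (B.subst σ)
  | imp A B, σ => imp (A.subst σ) (B.subst σ)
  | all A, σ => all (A.subst (up σ))
  | ex A, σ => ex (A.subst (up σ))

/-- The instance of the body `A` of a quantifier at the term `t`. -/
def inst (A : IForm L) (t : Tm L) : IForm L := A.subst (single t)

/-- `A`, viewed in the scope of one more quantifier (which does not bind anything in it). -/
def shift (A : IForm L) : IForm L := A.subst succVar

/-- The set of the free variables. -/
def fv : IForm L → Finset ℕ
  | rel _ ts => Finset.univ.biUnion (fun i => (ts i).varFinset)
  | top => ∅
  | bot => ∅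
  | and A B => A.fv ∪ B.fv
  | or A B => A.fv ∪ B.fv
  | imp A B => A.fv ∪ B.fv
  | all A => (A.fv.erase 0).image Nat.pred
  | ex A => (A.fv.erase 0).image Nat.pred

/-- `A` is a closed formula. -/
def Closed (A : IForm L) : Prop := A.fv = ∅

/-- `n` universal quantifiers in front. -/
def alls : ℕ → IForm L → IForm L
  | 0, A => A
  | n + 1, A => all (alls n A)

/-- The universal closure, as for `Form`. -/
def closure (A : IForm L) : IForm L :=
  alls A.fv.card (A.subst (fun i => FirstOrder.Language.Term.var (A.fv.filter (fun j => i < j)).card))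

/-- The translation `⋆`, which puts a double (defined) negation before every `∃`. -/
def star : IForm L → IForm L
  | rel R ts => rel R ts
  | top => top
  | bot => bot
  | and A B => and A.star B.star
  | or A B => or A.star B.star
  | imp A B => imp A.star B.star
  | all A => all A.star
  | ex A => (ex A.star).wneg.wneg

end IForm

/-- Derivability `Γ ⊢ A` in intuitionistic first-order logic `IQC` (natural deduction). -/
inductive IQC {L : FirstOrder.Language.{0, 0}} : Set (IForm L) → IForm L → Prop
  | ax {Γ : Set (IForm L)} {A : IForm L} : A ∈ Γ → IQC Γ A
  | topI {Γ : Set (IForm L)} : IQC Γ IForm.top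
  | botE {Γ : Set (IForm L)} {A : IForm L} : IQC Γ IForm.bot → IQC Γ A
  | andI {Γ : Set (IForm L)} {A B : IForm L} : IQC Γ A → IQC Γ B → IQC Γ (IForm.and A B)
  | andE₁ {Γ : Set (IForm L)} {A B : IForm L} : IQC Γ (IForm.and A B) → IQC Γ A
  | andE₂ {Γ : Set (IForm L)} {A B : IForm L} : IQC Γ (IForm.and A B) → IQC Γ B
  | orI₁ {Γ : Set (IForm L)} {A B : IForm L} : IQC Γ A → IQC Γ (IForm.or A B)
  | orI₂ {Γ : Set (IForm L)} {A B : IForm L} : IQC Γ B → IQC Γ (IForm.or A B)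
  | orE {Γ : Set (IForm L)} {A B C : IForm L} : IQC Γ (IForm.or A B) →
      IQC (insert A Γ) C → IQC (insert B Γ) C → IQC Γ C
  | impI {Γ : Set (IForm L)} {A B : IForm L} : IQC (insert A Γ) B → IQC Γ (IForm.imp A B)
  | impE {Γ : Set (IForm L)} {A B : IForm L} : IQC Γ (IForm.imp A B) → IQC Γ A → IQC Γ B
  | allI {Γ : Set (IForm L)} {A : IForm L} : IQC (IForm.shift '' Γ) A → IQC Γ (IForm.all A)
  | allE {Γ : Set (IForm L)} {A : IForm L} (t : Tm L) : IQC Γ (IForm.all A) → IQC Γ (A.inst t)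
  | exI {Γ : Set (IForm L)} {A : IForm L} (t : Tm L) : IQC Γ (A.inst t) → IQC Γ (IForm.ex A)
  | exE {Γ : Set (IForm L)} {A C : IForm L} : IQC Γ (IForm.ex A) →
      IQC (insert A (IForm.shift '' Γ)) C.shift → IQC Γ C

/-- Quantified here-and-there: the universal closures of `A ∨ (A → B) ∨ (B → ⊥)`. -/
def HTQ (L : FirstOrder.Language.{0, 0}) : Set (IForm L) :=
  {F | ∃ A B : IForm L, F = (IForm.or A (IForm.or (IForm.imp A B) B.wneg)).closure}

/-- Constant domain: the universal closures of `∀ x (C ∨ A) → C ∨ ∀ x A`, `x` not free in `C`. -/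
def CD (L : FirstOrder.Language.{0, 0}) : Set (IForm L) :=
  {F | ∃ A C : IForm L, F =
    (IForm.imp (IForm.all (IForm.or C.shift A)) (IForm.or C (IForm.all A))).closure}

/-- The logic `HTCD = IQC + HTQ + CD`, as the set of its (closed) theorems. -/
def HTCD (L : FirstOrder.Language.{0, 0}) : Set (IForm L) :=
  {A | A.Closed ∧ IQC (HTQ L ∪ CD L) A}

/-- The closed theorems of `NSF_P` in which neither `neg` nor `E` occurs. -/
def SFQPNegEFree (L : FirstOrder.Language.{0, 0}) : Set (IForm L) :=
  {A | A.Closed ∧ NSFP ∅ A.toForm}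

/-! ## Models -/

/-- The value of a term, given the interpretation of the function symbols and of the variables. -/
def termVal {L : FirstOrder.Language.{0, 0}} {D : Type u} {α : Type*}
    (fn : ∀ n : ℕ, L.Functions n → (Fin n → D) → D) (ρ : α → D) : L.Term α → D
  | FirstOrder.Language.Term.var a => ρ a
  | FirstOrder.Language.Term.func f ts => fn _ f (fun i => termVal fn ρ (ts i))

/-- The assignment of `d` to the variable `0` and of `ρ i` to `i + 1`. -/
def consEnv {D : Type u} (d : D) (ρ : ℕ → D) : ℕ → D
  | 0 => d
  | i + 1 => ρ i

/-- Strict finitistic models. A closed term of the language extended by names for the elements of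
the domain `D` is an element of `L.Term D`. -/
structure Model (L : FirstOrder.Language.{0, 0}) : Type (u + 1) where
  /-- the nodes -/
  K : Type u
  [order : PartialOrder K]
  /-- the frame is rooted -/
  rooted : ∃ r : K, ∀ k : K, r ≤ k
  /-- the frame is tree-like -/
  tree : ∀ k l m : K, l ≤ k → m ≤ k → l ≤ m ∨ m ≤ l
  /-- the height is at most `ω` -/
  height : ∀ k : K, (Set.Iic k).Finite
  /-- the branchings are at most countable -/
  branching : ∀ k : K, {l : K | k ⋖ l}.Countable
  /-- the constant domain -/
  D : Type u
  [nonempty : Nonempty D]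
  /-- the interpretation of the function symbols -/
  fn : ∀ n : ℕ, L.Functions n → (Fin n → D) → D
  /-- the extension of a predicate symbol other than `E` at a node -/
  rel : K → ∀ n : ℕ, L.Relations n → Set (Fin n → D)
  /-- the extension of `E` at a node -/
  ext : K → Set D
  rel_mono : ∀ (k k' : K), k ≤ k' → ∀ (n : ℕ) (R : L.Relations n), rel k n R ⊆ rel k' n R
  ext_mono : ∀ (k k' : K), k ≤ k' → ext k ⊆ ext k'
  /-- the strictness condition, for the predicate symbols other than `E` -/
  strict_rel : ∀ (k : K) (n : ℕ) (R : L.Relations n) (c : Fin n → L.Term D),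
    (fun i => termVal fn id (c i)) ∈ rel k n R →
    ∀ (i : Fin n) (c' : L.Term D), Subterm c' (c i) → termVal fn id c' ∈ ext k
  /-- the strictness condition, for `E` -/
  strict_ext : ∀ (k : K) (c : L.Term D), termVal fn id c ∈ ext k →
    ∀ c' : L.Term D, Subterm c' c → termVal fn id c' ∈ ext k
  /-- the finite verification condition -/
  finite_verification : ∀ k : K, {P : Σ n : ℕ, L.Relations n | (rel k P.1 P.2).Nonempty}.Finite

attribute [instance] Model.order Model.nonempty

/-- The actual verification relation `k ⊨ A`, for `A` under the assignment `ρ` of elements of the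
domain (in place of their names) to the free variables. -/
def Model.Forces {L : FirstOrder.Language.{0, 0}} (W : Model.{u} L) : Form L → W.K → (ℕ → W.D) → Prop
  | Form.rel R ts, k, ρ => (fun i => termVal W.fn ρ (ts i)) ∈ W.rel k _ R
  | Form.E t, k, ρ => termVal W.fn ρ t ∈ W.ext k
  | Form.top, _, _ => True
  | Form.bot, _, _ => False
  | Form.and A B, k, ρ => W.Forces A k ρ ∧ W.Forces B k ρ
  | Form.or A B, k, ρ => W.Forces A k ρ ∨ W.Forces B k ρ
  | Form.imp A B, k, ρ => ∀ k', k ≤ k' → W.Forces A k' ρ → ∃ k'', k' ≤ k'' ∧ W.Forces B k'' ρ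
  | Form.neg A, _, ρ => ∀ l, ¬ W.Forces A l ρ
  | Form.all A, k, ρ =>
      (A.GlobalOnly → ∀ d : W.D, ∀ k', k ≤ k' →
        ∃ k'', k' ≤ k'' ∧ W.Forces A k'' (consEnv d ρ)) ∧
      (¬ A.GlobalOnly → ∀ d : W.D, ∀ k', k ≤ k' → d ∈ W.ext k' →
        ∃ k'', k' ≤ k'' ∧ W.Forces A k'' (consEnv d ρ))
  | Form.ex A, k, ρ =>
      (A.GlobalOnly → ∃ d : W.D, W.Forces A k (consEnv d ρ)) ∧
      (¬ A.GlobalOnly → ∃ d : W.D, d ∈ W.ext k ∧ W.Forces A k (consEnv d ρ))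

/-- Strict finitistic validity `⊨_W^V A`: (the universal closure of) `A` is forced at every node.
The assignment `ρ` is irrelevant, as the universal closure has no free variables. -/
def Model.Valid {L : FirstOrder.Language.{0, 0}} (W : Model.{u} L) (A : Form L) : Prop :=
  ∀ (k : W.K) (ρ : ℕ → W.D), W.Forces A.closure k ρ

/-- The intuitionistic forcing relation `k ⊩ A`. -/
def Model.IForces {L : FirstOrder.Language.{0, 0}} (W : Model.{u} L) : IForm L → W.K → (ℕ → W.D) → Prop
  | IForm.rel R ts, k, ρ => (fun i => termVal W.fn ρ (ts i)) ∈ W.rel k _ R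
  | IForm.top, _, _ => True
  | IForm.bot, _, _ => False
  | IForm.and A B, k, ρ => W.IForces A k ρ ∧ W.IForces B k ρ
  | IForm.or A B, k, ρ => W.IForces A k ρ ∨ W.IForces B k ρ
  | IForm.imp A B, k, ρ => ∀ k', k ≤ k' → W.IForces A k' ρ → W.IForces B k' ρ
  | IForm.all A, k, ρ => ∀ d : W.D, ∀ k', k ≤ k' → W.IForces A k' (consEnv d ρ)
  | IForm.ex A, k, ρ => ∃ d : W.D, W.IForces A k (consEnv d ρ)

/-- Intuitionistic validity `⊩_W^V A`. -/
def Model.IValid {L : FirstOrder.Language.{0, 0}} (W : Model.{u} L) (A : IForm L) : Prop :=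
  ∀ (k : W.K) (ρ : ℕ → W.D), W.IForces A.closure k ρ

/-- Every formula (with parameters from the domain) forced at some node is forced above every
node. -/
def Model.FormulaPrevalence {L : FirstOrder.Language.{0, 0}} (W : Model.{u} L) : Prop :=
  ∀ (A : Form L) (ρ : ℕ → W.D), (∃ k, W.Forces A k ρ) →
    ∀ k, ∃ k', k ≤ k' ∧ W.Forces A k' ρ

/-- Every object of the domain satisfies `E` somewhere above every node. -/
def Model.ObjectPrevalence {L : FirstOrder.Language.{0, 0}} (W : Model.{u} L) : Prop :=
  ∀ (d : W.D) (k : W.K), ∃ k', k ≤ k' ∧ d ∈ W.ext k'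

/-- The class `W_P` of the prevalent models. -/
def WP (L : FirstOrder.Language.{0, 0}) : Set (Model.{u} L) :=
  {W | W.FormulaPrevalence ∧ W.ObjectPrevalence}

/-- The class `W_P2` of the two-node prevalent models. -/
def WP2 (L : FirstOrder.Language.{0, 0}) : Set (Model.{u} L) :=
  {W | W ∈ WP L ∧ Nat.card W.K = 2}

end SFQ

namespace SFQ

open FirstOrder Language

variable {L : FirstOrder.Language.{0, 0}}

/-! ## Substitution, free variables and the translation -/

/-! Part (i) holds model by model. One of the two nodes is a greatest node `t`, and by object
prevalence every object exists there. At `t` both relations are classical satisfaction. At any node,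
a strict finitistic `→`, `∀` or `∼∼∃` only asks about `t`, because "at some later node" amounts to
"at `t`" by persistence. Intuitionistic forcing of these formulas persists to `t`, hence implies
their strict finitistic forcing; atoms, `∧` and `∨` agree node by node.

Part (ii) is a syntactic version of a soundness argument. In `NSFP`, the formulas with derivable
double negation (`CL`) obey classical first-order logic, with every object existing. So one can
speak classically about the two-node constant-domain model with a classical structure on top and no
true atom at the root: `rootForm` expresses forcing of `A` at that root. Intuitionistic rules
preserve it (`CL.rootForm_of_iqc`), and the two axiom schemes satisfy it by excluded middle at the
root or on top (`CL.rootForm_htq`, `CL.rootForm_cd`). Hence `∼∼` of `rootForm A` is derivable for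
every theorem `A` of `HTCD`.

It remains to remove the double negation, which `NSFP` permits only for `STP` formulas. Between
`rootForm A` and the translation of `A` there is a disjunction of `ST` formulas
(`exists_disjST_interpolant`): implied classically by the former, and implying the latter outright.
The double negation is removed from this interpolant. -/

theorem Tm.subst_var (t : Tm L) : t.subst Term.var = t := by
  induction t with
  | var a => rfl
  | func f ts ih => simp only [Term.subst, ih]

theorem Tm.subst_subst (t : Tm L) (σ τ : ℕ → Tm L) :
    (t.subst σ).subst τ = t.subst (fun i => (σ i).subst τ) := by
  induction t with
  | var a => rfl
  | func f ts ih => simp only [Term.subst, ih]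

theorem Tm.relabel_subst (t : Tm L) (g : ℕ → ℕ) (τ : ℕ → Tm L) :
    (t.relabel g).subst τ = t.subst (fun i => τ (g i)) := by
  induction t with
  | var a => rfl
  | func f ts ih => simp only [Term.relabel, Term.subst, ih]

theorem Tm.subst_relabel (t : Tm L) (σ : ℕ → Tm L) (g : ℕ → ℕ) :
    (t.subst σ).relabel g = t.subst (fun i => (σ i).relabel g) := by
  induction t with
  | var a => rfl
  | func f ts ih => simp only [Term.relabel, Term.subst, ih]

theorem up_comp (σ τ : ℕ → Tm L) :
    (fun i => (up σ i).subst (up τ)) = up (fun i => (σ i).subst τ) := by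
  funext i
  cases i with
  | zero => rfl
  | succ i => simp only [up, Tm.relabel_subst, Tm.subst_relabel]

theorem up_var : up (Term.var : ℕ → Tm L) = Term.var := by
  funext i
  cases i <;> rfl

namespace IForm

theorem subst_var (A : IForm L) : A.subst Term.var = A := by
  induction A <;> simp_all [subst, up_var, Tm.subst_var]

theorem subst_subst (A : IForm L) (σ τ : ℕ → Tm L) :
    (A.subst σ).subst τ = A.subst (fun i => (σ i).subst τ) := by
  induction A generalizing σ τ <;> simp_all [subst, up_comp, Tm.subst_subst]

/-- Substitution commutes with shifting. -/
theorem shift_subst_up (A : IForm L) (σ : ℕ → Tm L) :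
    A.shift.subst (up σ) = (A.subst σ).shift := by
  simp only [shift, subst_subst]
  congr 1
  funext i
  change (σ i).relabel Nat.succ = _
  generalize σ i = t
  induction t with
  | var a => rfl
  | func f ts ih => simp only [Term.relabel, Term.subst, ih]

/-- De Bruijn form of instantiating at an eigenvariable: it recovers the body of a universal
hypothesis that was shifted under a new quantifier. -/
theorem subst_up_succVar_inst (A : IForm L) :
    (A.subst (up succVar)).inst (Term.var 0) = A := by
  rw [inst, subst_subst]
  conv_rhs => rw [← A.subst_var]
  congr 1
  funext i
  cases i <;> rfl

/-- Makes a substitution instance of a closed-off axiom a universal prefix over an instance of the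
same scheme. -/
theorem alls_subst (n : ℕ) (A : IForm L) (σ : ℕ → Tm L) :
    (alls n A).subst σ = alls n (A.subst (up^[n] σ)) := by
  induction n generalizing σ with
  | zero => rfl
  | succ n ih => simp only [alls, subst, ih, Function.iterate_succ_apply]

theorem fv_star (A : IForm L) : A.star.fv = A.fv := by
  induction A <;> simp_all [star, fv, wneg]

theorem fv_toForm (A : IForm L) : A.toForm.fv = A.fv := by
  induction A <;> simp_all [toForm, fv, Form.fv]

theorem star_subst (A : IForm L) (σ : ℕ → Tm L) : (A.subst σ).star = A.star.subst σ := by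
  induction A generalizing σ <;> simp_all [star, subst, wneg]

theorem toForm_subst (A : IForm L) (σ : ℕ → Tm L) :
    (A.subst σ).toForm = A.toForm.subst σ := by
  induction A generalizing σ <;> simp_all [toForm, subst, Form.subst]

theorem toForm_star_alls (n : ℕ) (A : IForm L) :
    (alls n A).star.toForm = Form.alls n A.star.toForm := by
  induction n with
  | zero => rfl
  | succ n ih => simp only [alls, star, toForm, Form.alls, ih]

theorem toForm_star_closure (A : IForm L) :
    A.closure.star.toForm = A.star.toForm.closure := by
  simp only [closure, Form.closure, toForm_star_alls, star_subst, toForm_subst, fv_toForm, fv_star]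

end IForm

/-! ## Two-node prevalent models -/

namespace Model

variable (W : Model.{u} L)

theorem Forces.mono {W : Model.{u} L} {A : Form L} {k l : W.K} {ρ : ℕ → W.D} (hkl : k ≤ l)
    (h : W.Forces A k ρ) : W.Forces A l ρ := by
  induction A generalizing ρ with
  | rel R ts => exact W.rel_mono _ _ hkl _ _ h
  | E t => exact W.ext_mono _ _ hkl h
  | top => trivial
  | bot => exact h
  | and A B ihA ihB => exact ⟨ihA h.1, ihB h.2⟩
  | or A B ihA ihB => exact h.imp ihA ihB
  | imp A B => exact fun k' hk' => h k' (hkl.trans hk')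
  | neg A => exact h
  | all A =>
    exact ⟨fun hA d k' hk' => h.1 hA d k' (hkl.trans hk'),
      fun hA d k' hk' => h.2 hA d k' (hkl.trans hk')⟩
  | ex A ih =>
    exact ⟨fun hA => (h.1 hA).imp fun d hd => ih hd,
      fun hA => (h.2 hA).imp fun d hd => ⟨W.ext_mono _ _ hkl hd.1, ih hd.2⟩⟩

theorem IForces.mono {W : Model.{u} L} {A : IForm L} {k l : W.K} {ρ : ℕ → W.D} (hkl : k ≤ l)
    (h : W.IForces A k ρ) : W.IForces A l ρ := by
  induction A generalizing ρ with
  | rel R ts => exact W.rel_mono _ _ hkl _ _ h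
  | top => trivial
  | bot => exact h
  | and A B ihA ihB => exact ⟨ihA h.1, ihB h.2⟩
  | or A B ihA ihB => exact h.imp ihA ihB
  | imp A B => exact fun k' hk' => h k' (hkl.trans hk')
  | all A => exact fun d k' hk' => h d k' (hkl.trans hk')
  | ex A ih => exact Exists.imp (fun d hd => ih hd) h

variable {W}

/-! ### Forcing below a greatest node -/

section Greatest

variable {t : W.K} (ht : ∀ k, k ≤ t)
include ht

/-- By persistence, whatever is forced at some later node is forced at `t`, so the node `k` plays no
role. -/
theorem forces_imp_iff_of_greatest {A B : Form L} {k : W.K} {ρ : ℕ → W.D} :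
    W.Forces (Form.imp A B) k ρ ↔ (W.Forces A t ρ → W.Forces B t ρ) := by
  refine ⟨fun h hA => ?_, fun h k' _ hA => ⟨t, ht k', h (hA.mono (ht k'))⟩⟩
  obtain ⟨k'', -, hB⟩ := h t (ht k) hA
  exact hB.mono (ht k'')

theorem forces_all_iff_of_greatest (hE : ∀ d, d ∈ W.ext t) {A : Form L} {k : W.K} {ρ : ℕ → W.D} :
    W.Forces (Form.all A) k ρ ↔ ∀ d, W.Forces A t (consEnv d ρ) := by
  constructor
  · intro h d
    by_cases hA : A.GlobalOnly
    · obtain ⟨k', -, hk'⟩ := h.1 hA d t (ht k)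
      exact hk'.mono (ht k')
    · obtain ⟨k', -, hk'⟩ := h.2 hA d t (ht k) (hE d)
      exact hk'.mono (ht k')
  · exact fun h => ⟨fun _ d k' _ => ⟨t, ht k', h d⟩, fun _ d k' _ _ => ⟨t, ht k', h d⟩⟩

omit ht in
theorem forces_ex_iff_of_ext_univ (hE : ∀ d, d ∈ W.ext t) {A : Form L} {ρ : ℕ → W.D} :
    W.Forces (Form.ex A) t ρ ↔ ∃ d, W.Forces A t (consEnv d ρ) := by
  constructor
  · intro h
    by_cases hA : A.GlobalOnly
    · exact h.1 hA
    · exact (h.2 hA).imp fun d hd => hd.2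
  · exact fun h => ⟨fun _ => h, fun _ => h.imp fun d hd => ⟨hE d, hd⟩⟩

/-- The double negation moves the existential to `t`, where its witness exists. This is what `⋆` is
for: an intuitionistic witness at `k` need not satisfy `E` at `k`. -/
theorem forces_star_ex_iff_of_greatest (hE : ∀ d, d ∈ W.ext t) {A : IForm L} {k : W.K}
    {ρ : ℕ → W.D} :
    W.Forces A.ex.star.toForm k ρ ↔ ∃ d, W.Forces A.star.toForm t (consEnv d ρ) := by
  rw [← forces_ex_iff_of_ext_univ hE]
  simp only [IForm.star, IForm.wneg, IForm.toForm, forces_imp_iff_of_greatest ht]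
  simp only [Forces, imp_false, not_not]

/-- At a greatest node the two forcing relations are both classical satisfaction. -/
theorem forces_star_iff_iForces_of_greatest (hE : ∀ d, d ∈ W.ext t) {A : IForm L} {ρ : ℕ → W.D} :
    W.Forces A.star.toForm t ρ ↔ W.IForces A t ρ := by
  have hmax : ∀ k, t ≤ k → k = t := fun k hk => le_antisymm (ht k) hk
  induction A generalizing ρ with
  | rel R ts => rfl
  | top => rfl
  | bot => rfl
  | and A B ihA ihB => exact and_congr ihA ihB
  | or A B ihA ihB => exact or_congr ihA ihB
  | imp A B ihA ihB =>
    simp only [IForm.star, IForm.toForm, forces_imp_iff_of_greatest ht, ihA, ihB]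
    refine ⟨fun h k hk => ?_, fun h => h t le_rfl⟩
    rw [hmax k hk]
    exact h
  | all A ih =>
    simp only [IForm.star, IForm.toForm, forces_all_iff_of_greatest ht hE, ih]
    refine ⟨fun h d k hk => ?_, fun h d => h d t le_rfl⟩
    rw [hmax k hk]
    exact h d
  | ex A ih =>
    simp only [forces_star_ex_iff_of_greatest ht hE, ih]
    rfl

/-- `→`, `∀` and `∃` are carried to `t`, where the relations coincide; only `∧` and `∨` need the
induction hypothesis at `k`. -/
theorem IForces.forces_star (hE : ∀ d, d ∈ W.ext t) {A : IForm L} {k : W.K} {ρ : ℕ → W.D}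
    (h : W.IForces A k ρ) : W.Forces A.star.toForm k ρ := by
  have top_iff := fun (A : IForm L) (ρ : ℕ → W.D) =>
    forces_star_iff_iForces_of_greatest ht hE (A := A) (ρ := ρ)
  induction A generalizing ρ with
  | rel R ts => exact h
  | top => trivial
  | bot => exact h
  | and A B ihA ihB => exact ⟨ihA h.1, ihB h.2⟩
  | or A B ihA ihB => exact Or.imp ihA ihB h
  | imp A B =>
    simp only [IForm.star, IForm.toForm, forces_imp_iff_of_greatest ht, top_iff]
    exact h t (ht k)
  | all A =>
    simp only [IForm.star, IForm.toForm, forces_all_iff_of_greatest ht hE, top_iff]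
    exact fun d => h d t (ht k)
  | ex A =>
    simp only [forces_star_ex_iff_of_greatest ht hE, top_iff]
    exact Exists.imp (fun d hd => IForces.mono (ht k) hd) h

end Greatest

theorem exists_greatest_of_card_eq_two (h : Nat.card W.K = 2) : ∃ t : W.K, ∀ k, k ≤ t := by
  obtain ⟨r, hr⟩ := W.rooted
  obtain ⟨x, y, -, hxy⟩ := Nat.card_eq_two_iff.1 h
  have hall : ∀ k, k = x ∨ k = y := fun k => by
    have : k ∈ ({x, y} : Set W.K) := hxy ▸ Set.mem_univ k
    simpa using this
  rcases hall r with rfl | rfl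
  · exact ⟨y, fun k => (hall k).elim (fun e => e ▸ hr y) fun e => e.le⟩
  · exact ⟨x, fun k => (hall k).elim (fun e => e.le) fun e => e ▸ hr x⟩

theorem valid_star_of_iValid (hW : W ∈ WP2 L) {A : IForm L} (h : W.IValid A) :
    W.Valid A.star.toForm := by
  obtain ⟨⟨-, hO⟩, hcard⟩ := hW
  obtain ⟨t, ht⟩ := exists_greatest_of_card_eq_two hcard
  have hE : ∀ d, d ∈ W.ext t := fun d => by
    obtain ⟨k, -, hk⟩ := hO d t
    exact W.ext_mono _ _ (ht k) hk
  intro k ρ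
  rw [← IForm.toForm_star_closure]
  exact IForces.forces_star ht hE (h k ρ)

end Model

/-! ## The classical logic of double negations in `NSF_P` -/

namespace NSFP

theorem mono {Γ Δ : Set (Form L)} {A : Form L} (h : NSFP Γ A) (hΓ : Γ ⊆ Δ) : NSFP Δ A := by
  induction h generalizing Δ with
  | ax h => exact ax (hΓ h)
  | topI => exact topI
  | botE _ ih => exact botE (ih hΓ)
  | andI _ _ ihA ihB => exact andI (ihA hΓ) (ihB hΓ)
  | andE₁ _ ih => exact andE₁ (ih hΓ)
  | andE₂ _ ih => exact andE₂ (ih hΓ)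
  | orI₁ _ ih => exact orI₁ (ih hΓ)
  | orI₂ _ ih => exact orI₂ (ih hΓ)
  | orE _ _ _ ih ihA ihB =>
    exact orE (ih hΓ) (ihA (Set.insert_subset_insert hΓ)) (ihB (Set.insert_subset_insert hΓ))
  | str₁ i _ ih => exact str₁ i (ih hΓ)
  | str₂ i _ ih => exact str₂ i (ih hΓ)
  | stP hS _ ih => exact stP hS (ih hΓ)
  | impI _ ih => exact impI (ih (Set.insert_subset_insert hΓ))
  | impE _ _ ih ihA => exact impE (ih hΓ) (ihA hΓ)
  | negIP _ ih => exact negIP (ih hΓ)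
  | negE _ _ ih ihA => exact negE (ih hΓ) (ihA hΓ)
  | dne => exact dne
  | obj => exact obj
  | allIP _ ih => exact allIP (ih (Set.image_mono hΓ))
  | allEP t _ ih => exact allEP t (ih hΓ)
  | exGloI t hA _ ih => exact exGloI t hA (ih hΓ)
  | exLocI t hA _ _ ih ihE => exact exLocI t hA (ih hΓ) (ihE hΓ)
  | exGloE hA _ _ ih ihC =>
    exact exGloE hA (ih hΓ) (ihC (Set.insert_subset_insert (Set.image_mono hΓ)))
  | exLocE hA _ _ ih ihC =>
    exact exLocE hA (ih hΓ)
      (ihC (Set.insert_subset_insert (Set.insert_subset_insert (Set.image_mono hΓ))))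

theorem weaken {Γ : Set (Form L)} {A : Form L} (B : Form L) (h : NSFP Γ A) :
    NSFP (insert B Γ) A :=
  h.mono (Set.subset_insert _ _)

theorem hyp {Γ : Set (Form L)} {A : Form L} : NSFP (insert A Γ) A :=
  ax (Set.mem_insert _ _)

/-- `impE` yields only `∼∼⊥`; as `⊥` is global negative, `stP` reduces this to `⊥`. -/
theorem wnegE {Γ : Set (Form L)} {A : Form L} (h : NSFP Γ A.wneg) (hA : NSFP Γ A) :
    NSFP Γ Form.bot :=
  stP (.st _ (.gn _ trivial)) (impE h hA)

theorem wnegI {Γ : Set (Form L)} {A : Form L} (h : NSFP (insert A Γ) Form.bot) :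
    NSFP Γ A.wneg :=
  impI (botE h)

end NSFP

/-- `∼∼A` is derivable in `NSF_P`. Such formulas `A` obey classical logic. -/
def CL (Γ : Set (Form L)) (A : Form L) : Prop := NSFP Γ A.wneg.wneg

namespace CL

open NSFP

variable {Γ Δ : Set (Form L)} {A B C : Form L}

theorem mono (h : CL Γ A) (hΓ : Γ ⊆ Δ) : CL Δ A := NSFP.mono h hΓ

theorem weaken (B : Form L) (h : CL Γ A) : CL (insert B Γ) A := NSFP.weaken B h

theorem of_nsfp (h : NSFP Γ A) : CL Γ A := wnegI (wnegE hyp (h.weaken _))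

theorem hyp : CL (insert A Γ) A := of_nsfp .hyp

theorem ax (h : A ∈ Γ) : CL Γ A := of_nsfp (.ax h)

theorem cut (hA : CL Γ A) (hB : CL (insert A Γ) B) : CL Γ B := by
  refine wnegI (wnegE (A := A.wneg) (hA.weaken _) (wnegI (wnegE (A := B.wneg) ?_ ?_)))
  · exact NSFP.mono hB (Set.insert_subset_insert (Set.subset_insert _ _))
  · exact NSFP.hyp.weaken _

/-- Double negation behaves as a monad: towards a doubly negated goal, `∼∼A` may be replaced by `A`
itself in an enlarged context. -/
theorem bind (hA : CL Γ A) (hB : ∀ Δ, Γ ⊆ Δ → NSFP Δ A → CL Δ B) : CL Γ B :=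
  hA.cut (hB _ (Set.subset_insert _ _) .hyp)

theorem botE (h : CL Γ Form.bot) : CL Γ A := h.bind fun _ _ h => of_nsfp (.botE h)

theorem topI : CL Γ Form.top := of_nsfp .topI

theorem andI (hA : CL Γ A) (hB : CL Γ B) : CL Γ (Form.and A B) :=
  hA.bind fun _ h hA => (hB.mono h).bind fun _ h hB => of_nsfp (.andI (hA.mono h) hB)

theorem andE₁ (h : CL Γ (Form.and A B)) : CL Γ A := h.bind fun _ _ h => of_nsfp (.andE₁ h)

theorem andE₂ (h : CL Γ (Form.and A B)) : CL Γ B := h.bind fun _ _ h => of_nsfp (.andE₂ h)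

theorem orI₁ (h : CL Γ A) : CL Γ (Form.or A B) := h.bind fun _ _ h => of_nsfp (.orI₁ h)

theorem orI₂ (h : CL Γ B) : CL Γ (Form.or A B) := h.bind fun _ _ h => of_nsfp (.orI₂ h)

theorem orE (h : CL Γ (Form.or A B)) (hA : CL (insert A Γ) C) (hB : CL (insert B Γ) C) :
    CL Γ C :=
  h.bind fun _ hΓ h => NSFP.orE h (NSFP.mono hA (Set.insert_subset_insert hΓ))
    (NSFP.mono hB (Set.insert_subset_insert hΓ))

theorem impI (h : CL (insert A Γ) B) : CL Γ (Form.imp A B) := of_nsfp (.impI h)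

/-- The conclusion of `NSFP.impE` is a double negation, so it is already a `CL` statement. -/
theorem impE (h : CL Γ (Form.imp A B)) (hA : CL Γ A) : CL Γ B :=
  h.bind fun _ hΓ h => (hA.mono hΓ).bind fun _ hΔ hA => NSFP.impE (h.mono hΔ) hA

/-- Excluded middle, as a rule. -/
theorem by_cases (A : Form L) (h : CL (insert A Γ) C) (h' : CL (insert A.wneg Γ) C) : CL Γ C := by
  refine wnegI (wnegE (A := A.wneg) ?_ ?_)
  · refine wnegI (wnegE (A := C.wneg) ?_ (NSFP.hyp.weaken _))
    exact NSFP.mono h' (Set.insert_subset_insert (Set.subset_insert _ _))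
  · refine wnegI (wnegE (A := C.wneg) ?_ (NSFP.hyp.weaken _))
    exact NSFP.mono h (Set.insert_subset_insert (Set.subset_insert _ _))

theorem wneg_wnegE (h : CL Γ A.wneg.wneg) : CL Γ A :=
  h.bind fun _ _ h => h

theorem allI (h : CL (Form.shift '' Γ) A) : CL Γ (Form.all A) := of_nsfp (.allIP h)

theorem allE (t : Tm L) (h : CL Γ (Form.all A)) : CL Γ (A.inst t) :=
  h.bind fun _ _ h => NSFP.allEP t h

/-- From the axioms `∀x¬¬E(x)` and `¬¬A → A`. Up to `∼∼` every term denotes an existing object,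
which erases the difference between local and global introduction of `∃`. -/
theorem exists_E (t : Tm L) : CL Γ (Form.E t) :=
  impE (of_nsfp .dne) (allE (A := Form.neg (Form.neg (Form.E (Term.var 0)))) t (of_nsfp .obj))

theorem exI (t : Tm L) (h : CL Γ (A.inst t)) : CL Γ (Form.ex A) := by
  by_cases hA : A.GlobalOnly
  · exact h.bind fun _ _ h => of_nsfp (.exGloI t hA h)
  · exact h.bind fun _ _ h => (exists_E t).bind fun _ hΔ hE =>
      of_nsfp (.exLocI t hA (h.mono hΔ) hE)

theorem exE (h : CL Γ (Form.ex A)) (hC : CL (insert A (Form.shift '' Γ)) C.shift) : CL Γ C := by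
  refine h.bind fun Δ hΓ h => ?_
  by_cases hA : A.GlobalOnly
  · exact NSFP.exGloE hA h (NSFP.mono hC (Set.insert_subset_insert (Set.image_mono hΓ)))
  · exact NSFP.exLocE hA h (NSFP.mono hC
      (Set.insert_subset_insert ((Set.image_mono hΓ).trans (Set.subset_insert _ _))))

end CL

/-! ## Forcing at an atomless root below a classical model, as a formula -/

namespace IForm

/-- The translation `⋆`, with values in the full language. -/
def starForm (A : IForm L) : Form L := A.star.toForm

/-- The formula which holds in a classical structure iff `A` is intuitionistically forced at the
root of the two-node model that has this structure on top and no true atoms at the root. -/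
def rootForm : IForm L → Form L
  | rel _ _ => Form.bot
  | top => Form.top
  | bot => Form.bot
  | and A B => Form.and A.rootForm B.rootForm
  | or A B => Form.or A.rootForm B.rootForm
  | imp A B => Form.and (imp A B).starForm (Form.imp A.rootForm B.rootForm)
  | all A => Form.and (all A).starForm (Form.all A.rootForm)
  | ex A => Form.and (ex A).starForm (Form.ex A.rootForm)

theorem starForm_subst (A : IForm L) (σ : ℕ → Tm L) :
    (A.subst σ).starForm = A.starForm.subst σ := by
  rw [starForm, star_subst, toForm_subst, starForm]

theorem rootForm_subst (A : IForm L) (σ : ℕ → Tm L) :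
    (A.subst σ).rootForm = A.rootForm.subst σ := by
  induction A generalizing σ with
  | imp A B ihA ihB =>
    simp only [subst, rootForm, Form.subst, ihA, ihB, ← starForm_subst]
  | all A ih => simp only [subst, rootForm, Form.subst, ih, ← starForm_subst]
  | ex A ih => simp only [subst, rootForm, Form.subst, ih, ← starForm_subst]
  | _ => simp_all [subst, rootForm, Form.subst]

theorem starForm_image_shift (Γ : Set (IForm L)) :
    starForm '' (shift '' Γ) = Form.shift '' (starForm '' Γ) := by
  simp only [Set.image_image, shift, starForm_subst, Form.shift]

theorem rootForm_image_shift (Γ : Set (IForm L)) :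
    rootForm '' (shift '' Γ) = Form.shift '' (rootForm '' Γ) := by
  simp only [Set.image_image, shift, rootForm_subst, Form.shift]

end IForm

/-! ### Soundness of `IQC` for truth on top and forcing at the root -/

namespace CL

open IForm

variable {Γ : Set (Form L)}

/-- The formulas forced at the root are true on top. -/
theorem starForm_of_rootForm {A : IForm L} (h : CL Γ A.rootForm) : CL Γ A.starForm := by
  induction A generalizing Γ with
  | rel R ts => exact h.botE
  | top => exact h
  | bot => exact h
  | and A B ihA ihB => exact andI (ihA h.andE₁) (ihB h.andE₂)
  | or A B ihA ihB => exact orE h (ihA hyp).orI₁ (ihB hyp).orI₂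
  | imp A B => exact h.andE₁
  | all A => exact h.andE₁
  | ex A => exact h.andE₁

theorem starForm_ex_iff {A : IForm L} : CL Γ (IForm.ex A).starForm ↔ CL Γ (Form.ex A.starForm) :=
  ⟨wneg_wnegE, fun h => of_nsfp h⟩

/-- The formulas all of whose substitution instances are derivably forced at the root. -/
def rootTheorems (L : FirstOrder.Language.{0, 0}) : Set (IForm L) :=
  {X | ∀ (σ : ℕ → Tm L) (Γ : Set (Form L)), CL Γ (X.subst σ).rootForm}

theorem rootForm_of_mem_rootTheorems {X : IForm L} (h : X ∈ rootTheorems L) :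
    CL Γ X.rootForm := by
  simpa only [subst_var] using h Term.var Γ

theorem shift_mem_rootTheorems {X : IForm L} (h : X ∈ rootTheorems L) :
    X.shift ∈ rootTheorems L := fun σ Γ => by
  rw [IForm.shift, subst_subst]
  exact h _ Γ

theorem insert_subset_union {α : Type*} {s t u : Set α} {a : α} (h : s ⊆ t ∪ u) :
    insert a s ⊆ insert a t ∪ u := by
  rw [Set.insert_union]
  exact Set.insert_subset_insert h

/-- Quantifier rules shift the axioms along with the other hypotheses; closure of `rootTheorems`
under substitution absorbs this. -/
theorem image_shift_subset {Γ Δ : Set (IForm L)} (h : Γ ⊆ Δ ∪ rootTheorems L) :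
    IForm.shift '' Γ ⊆ IForm.shift '' Δ ∪ rootTheorems L := by
  rintro _ ⟨X, hX, rfl⟩
  exact (h hX).imp (Set.mem_image_of_mem _) shift_mem_rootTheorems

/-- Soundness of `IQC` on the top node. -/
theorem starForm_of_iqc {Γ Δ : Set (IForm L)} {A : IForm L} (h : IQC Γ A)
    (hΓ : Γ ⊆ Δ ∪ rootTheorems L) : CL (starForm '' Δ) A.starForm := by
  induction h generalizing Δ with
  | ax h =>
    rcases hΓ h with h | h
    · exact ax (Set.mem_image_of_mem _ h)
    · exact starForm_of_rootForm (rootForm_of_mem_rootTheorems h)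
  | topI => exact topI
  | botE _ ih => exact (ih hΓ).botE
  | andI _ _ ihA ihB => exact andI (ihA hΓ) (ihB hΓ)
  | andE₁ _ ih => exact (ih hΓ).andE₁
  | andE₂ _ ih => exact (ih hΓ).andE₂
  | orI₁ _ ih => exact (ih hΓ).orI₁
  | orI₂ _ ih => exact (ih hΓ).orI₂
  | orE _ _ _ ih ihA ihB =>
    have hA := ihA (insert_subset_union hΓ)
    have hB := ihB (insert_subset_union hΓ)
    rw [Set.image_insert_eq] at hA hB
    exact orE (ih hΓ) hA hB
  | impI _ ih =>
    have h := ih (insert_subset_union hΓ)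
    rw [Set.image_insert_eq] at h
    exact impI h
  | impE _ _ ih ihA => exact impE (ih hΓ) (ihA hΓ)
  | allI _ ih =>
    have h := ih (image_shift_subset hΓ)
    rw [starForm_image_shift] at h
    exact allI h
  | allE t _ ih =>
    rw [IForm.inst, starForm_subst]
    exact allE t (ih hΓ)
  | exI t _ ih =>
    have h := ih hΓ
    rw [IForm.inst, starForm_subst] at h
    exact starForm_ex_iff.2 (exI t h)
  | exE _ _ ih ihC =>
    have h := ihC (insert_subset_union (image_shift_subset hΓ))
    rw [Set.image_insert_eq, starForm_image_shift, IForm.shift, starForm_subst] at h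
    exact exE (starForm_ex_iff.1 (ih hΓ)) h

/-- The context for forcing at the root. -/
def rootContext (Δ : Set (IForm L)) : Set (Form L) := rootForm '' Δ ∪ starForm '' Δ

/-- The `starForm` copy of the new hypothesis is recovered from its `rootForm` copy. -/
theorem of_insert_rootContext {Δ : Set (IForm L)} {A : IForm L} {C : Form L}
    (h : CL (rootContext (insert A Δ)) C) : CL (insert A.rootForm (rootContext Δ)) C := by
  refine cut (starForm_of_rootForm hyp) (h.mono ?_)
  simp only [rootContext, Set.image_insert_eq]
  intro X hX
  simp only [Set.mem_union, Set.mem_insert_iff] at hX ⊢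
  tauto

theorem rootContext_image_shift (Δ : Set (IForm L)) :
    rootContext (IForm.shift '' Δ) = Form.shift '' rootContext Δ := by
  simp only [rootContext, Set.image_union, starForm_image_shift, rootForm_image_shift]

/-- Soundness of `IQC` on the root. -/
theorem rootForm_of_iqc {Γ Δ : Set (IForm L)} {A : IForm L} (h : IQC Γ A)
    (hΓ : Γ ⊆ Δ ∪ rootTheorems L) : CL (rootContext Δ) A.rootForm := by
  -- Supplies the conjunct "true on top" of `rootForm` for `→`, `∀` and `∃`.
  have star : ∀ {Γ Δ : Set (IForm L)} {A : IForm L}, IQC Γ A → Γ ⊆ Δ ∪ rootTheorems L →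
      CL (rootContext Δ) A.starForm := fun h hΓ =>
    (starForm_of_iqc h hΓ).mono Set.subset_union_right
  induction h generalizing Δ with
  | ax h =>
    rcases hΓ h with h | h
    · exact ax (Or.inl (Set.mem_image_of_mem _ h))
    · exact rootForm_of_mem_rootTheorems h
  | topI => exact topI
  | botE _ ih => exact (ih hΓ).botE
  | andI _ _ ihA ihB => exact andI (ihA hΓ) (ihB hΓ)
  | andE₁ _ ih => exact (ih hΓ).andE₁
  | andE₂ _ ih => exact (ih hΓ).andE₂
  | orI₁ _ ih => exact (ih hΓ).orI₁
  | orI₂ _ ih => exact (ih hΓ).orI₂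
  | orE _ _ _ ih ihA ihB =>
    exact orE (ih hΓ) (of_insert_rootContext (ihA (insert_subset_union hΓ)))
      (of_insert_rootContext (ihB (insert_subset_union hΓ)))
  | impI h ih =>
    exact andI (star (.impI h) hΓ) (impI (of_insert_rootContext (ih (insert_subset_union hΓ))))
  | impE _ _ ih ihA => exact impE (ih hΓ).andE₂ (ihA hΓ)
  | allI h ih =>
    have h' := ih (image_shift_subset hΓ)
    rw [rootContext_image_shift] at h'
    exact andI (star (.allI h) hΓ) (allI h')
  | allE t _ ih =>
    rw [IForm.inst, rootForm_subst]
    exact allE t (ih hΓ).andE₂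
  | exI t h ih =>
    have h' := ih hΓ
    rw [IForm.inst, rootForm_subst] at h'
    exact andI (star (.exI t h) hΓ) (exI t h')
  | exE _ _ ih ihC =>
    have h := of_insert_rootContext (ihC (insert_subset_union (image_shift_subset hΓ)))
    rw [rootContext_image_shift, IForm.shift, rootForm_subst] at h
    exact exE (ih hΓ).andE₂ h

/-! ### The axioms of `HTCD` -/

/-- If `B` is true on top, either `A` is forced at the root, or `A → B` is, vacuously there and
trivially on top. If `B` is false on top, it fails at both nodes, so `∼B` is forced. -/
theorem rootForm_htq (A B : IForm L) :
    CL Γ (IForm.or A (IForm.or (IForm.imp A B) B.wneg)).rootForm := by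
  refine by_cases B.starForm ?_ ?_
  · refine by_cases A.rootForm (orI₁ hyp) (orI₂ (orI₁ (andI (impI ?_) (impI ?_))))
    · exact (hyp.weaken _).weaken _
    · exact botE (impE (hyp.weaken _) hyp)
  · refine orI₂ (orI₂ (andI hyp (impI ?_)))
    exact impE (hyp.weaken _) (starForm_of_rootForm hyp)

/-- The instance at the bound variable, under one more quantifier. -/
theorem rootForm_of_mem_shift {A : IForm L} (h : (Form.all A.rootForm).shift ∈ Γ) :
    CL Γ A.rootForm := by
  have h' := allE (Term.var 0) (ax h)
  rwa [← rootForm_subst, Form.inst, ← rootForm_subst, ← IForm.inst, subst_up_succVar_inst] at h'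

theorem starForm_of_mem_shift {A : IForm L} (h : (Form.all A.starForm).shift ∈ Γ) :
    CL Γ A.starForm := by
  have h' := allE (Term.var 0) (ax h)
  rwa [← starForm_subst, Form.inst, ← starForm_subst, ← IForm.inst, subst_up_succVar_inst] at h'

theorem starForm_cd (A C : IForm L) :
    CL Γ (IForm.imp (IForm.all (IForm.or C.shift A)) (IForm.or C (IForm.all A))).starForm := by
  refine impI (by_cases C.starForm (orI₁ hyp) (orI₂ (allI ?_)))
  refine orE (starForm_of_mem_shift (A := IForm.or C.shift A) ?_) (botE ?_) hyp
  · exact Set.mem_image_of_mem _ (Set.mem_insert_of_mem _ (Set.mem_insert _ _))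
  · refine impE (ax (Set.mem_insert_of_mem _ (Set.mem_image_of_mem _ (Set.mem_insert _ _)))) ?_
    rw [← starForm_subst]
    exact hyp

/-- The domain being constant, `∀` at the root is a classical quantifier over root forcing; if `C`
fails at the root, every instance of `A` must be forced there. -/
theorem rootForm_cd (A C : IForm L) :
    CL Γ (IForm.imp (IForm.all (IForm.or C.shift A)) (IForm.or C (IForm.all A))).rootForm := by
  refine andI (starForm_cd A C) (impI (by_cases C.rootForm (orI₁ hyp) (orI₂ ?_)))
  -- The universal conjunct becomes a hypothesis of its own, so that its shift can be instantiated
  -- at the eigenvariable.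
  refine cut (A := Form.all (IForm.or C.shift A).rootForm) (andE₂ (hyp.weaken _)) ?_
  have key : CL (Form.shift '' insert (Form.all (IForm.or C.shift A).rootForm)
      (insert C.rootForm.wneg (insert (IForm.all (IForm.or C.shift A)).rootForm Γ)))
      A.rootForm := by
    refine orE (rootForm_of_mem_shift (A := IForm.or C.shift A) ?_) (botE ?_) hyp
    · exact Set.mem_image_of_mem _ (Set.mem_insert _ _)
    · refine impE (ax (Set.mem_insert_of_mem _ (Set.mem_image_of_mem _
        (Set.mem_insert_of_mem _ (Set.mem_insert _ _))))) ?_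
      rw [← rootForm_subst]
      exact hyp
  exact andI (allI (starForm_of_rootForm key)) (allI key)

theorem rootForm_alls {A : IForm L} (h : ∀ Γ : Set (Form L), CL Γ A.rootForm) (n : ℕ)
    (Γ : Set (Form L)) : CL Γ (alls n A).rootForm := by
  induction n generalizing Γ with
  | zero => exact h Γ
  | succ n ih => exact andI (allI (starForm_of_rootForm (ih _))) (allI (ih _))

theorem htq_subset_rootTheorems : HTQ L ⊆ rootTheorems L := by
  rintro _ ⟨A, B, rfl⟩ σ Γ
  rw [IForm.closure, alls_subst]
  exact rootForm_alls (fun Γ => rootForm_htq _ _) _ _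

theorem cd_subset_rootTheorems : CD L ⊆ rootTheorems L := by
  rintro _ ⟨A, C, rfl⟩ σ Γ
  rw [IForm.closure, alls_subst]
  refine rootForm_alls (fun Γ => ?_) _ _
  simp only [IForm.subst, shift_subst_up]
  exact rootForm_cd _ _

end CL

/-! ## Elimination of the outermost double negation -/

/-- The disjunctions of formulas in `ST`. -/
inductive Form.DisjST : Form L → Prop
  | st (S : Form L) : S.ST → DisjST S
  | or (S T : Form L) : DisjST S → DisjST T → DisjST (Form.or S T)

theorem Form.DisjST.stp {S : Form L} (h : S.DisjST) : S.STP := by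
  induction h with
  | st S h => exact .st S h
  | or S T _ _ ihS ihT => exact .or S T ihS ihT

/-- By distributivity, `DisjST` is closed under conjunction up to equivalence. -/
theorem Form.DisjST.exists_and {S T : Form L} (hS : S.DisjST) (hT : T.DisjST) :
    ∃ U : Form L, U.DisjST ∧ (∀ Γ, NSFP Γ U → NSFP Γ (Form.and S T)) ∧
      ∀ Γ, NSFP Γ S → NSFP Γ T → NSFP Γ U := by
  induction hS with
  | st S hS =>
    induction hT with
    | st T hT => exact ⟨Form.and S T, .st _ (.and S T hS hT), fun _ h => h, fun _ => .andI⟩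
    | or T₁ T₂ _ _ ih₁ ih₂ =>
      obtain ⟨U₁, hU₁, e₁, i₁⟩ := ih₁
      obtain ⟨U₂, hU₂, e₂, i₂⟩ := ih₂
      refine ⟨Form.or U₁ U₂, .or _ _ hU₁ hU₂, fun Γ h => ?_, fun Γ hS hT => ?_⟩
      · exact .orE h (.andI (e₁ _ .hyp).andE₁ (e₁ _ .hyp).andE₂.orI₁)
          (.andI (e₂ _ .hyp).andE₁ (e₂ _ .hyp).andE₂.orI₂)
      · exact .orE hT (i₁ _ (hS.weaken _) .hyp).orI₁ (i₂ _ (hS.weaken _) .hyp).orI₂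
  | or S₁ S₂ _ _ ih₁ ih₂ =>
    obtain ⟨U₁, hU₁, e₁, i₁⟩ := ih₁
    obtain ⟨U₂, hU₂, e₂, i₂⟩ := ih₂
    refine ⟨Form.or U₁ U₂, .or _ _ hU₁ hU₂, fun Γ h => ?_, fun Γ hS hT => ?_⟩
    · exact .orE h (.andI (e₁ _ .hyp).andE₁.orI₁ (e₁ _ .hyp).andE₂)
        (.andI (e₂ _ .hyp).andE₁.orI₂ (e₂ _ .hyp).andE₂)
    · exact .orE hS (i₁ _ .hyp (hT.weaken _)).orI₁ (i₂ _ .hyp (hT.weaken _)).orI₂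

/-- What is forced at the root implies classically a stable formula, which in turn implies the
translation. -/
theorem exists_disjST_interpolant (A : IForm L) :
    ∃ S : Form L, S.DisjST ∧ (∀ Γ, CL Γ A.rootForm → CL Γ S) ∧
      ∀ Γ, NSFP Γ S → NSFP Γ A.starForm := by
  induction A with
  -- No atom is forced at the root, so `⊥` interpolates and yields the atom by ex falso.
  | rel R ts => exact ⟨Form.bot, .st _ (.gn _ trivial), fun _ h => h, fun _ => .botE⟩
  | top => exact ⟨Form.top, .st _ .top, fun _ h => h, fun _ h => h⟩
  | bot => exact ⟨Form.bot, .st _ (.gn _ trivial), fun _ h => h, fun _ h => h⟩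
  | and A B ihA ihB =>
    obtain ⟨S, hS, iS, eS⟩ := ihA
    obtain ⟨T, hT, iT, eT⟩ := ihB
    obtain ⟨U, hU, eU, iU⟩ := hS.exists_and hT
    refine ⟨U, hU, fun Γ h => ?_, fun Γ h => ?_⟩
    · exact (iS _ h.andE₁).bind fun _ hΔ hS => (iT _ (h.andE₂.mono hΔ)).bind fun _ hΘ hT =>
        .of_nsfp (iU _ (hS.mono hΘ) hT)
    · exact .andI (eS _ (eU _ h).andE₁) (eT _ (eU _ h).andE₂)
  | or A B ihA ihB =>
    obtain ⟨S, hS, iS, eS⟩ := ihA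
    obtain ⟨T, hT, iT, eT⟩ := ihB
    exact ⟨Form.or S T, .or _ _ hS hT, fun Γ h => .orE h (iS _ .hyp).orI₁ (iT _ .hyp).orI₂,
      fun Γ h => .orE h (eS _ .hyp).orI₁ (eT _ .hyp).orI₂⟩
  -- Here and in the next two cases the translation is itself in `ST`, `∼∼∃` being an implication,
  -- and it is the first conjunct of `rootForm`.
  | imp A B => exact ⟨_, .st _ (.imp _ _), fun _ h => h.andE₁, fun _ h => h⟩
  | all A => exact ⟨_, .st _ (.all _), fun _ h => h.andE₁, fun _ h => h⟩
  | ex A => exact ⟨_, .st _ (.imp _ _), fun _ h => h.andE₁, fun _ h => h⟩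

theorem star_mem_sfqpNegEFree {A : IForm L} (hA : A ∈ HTCD L) : A.star ∈ SFQPNegEFree L := by
  obtain ⟨hclosed, h⟩ := hA
  refine ⟨by rw [IForm.Closed, IForm.fv_star]; exact hclosed, ?_⟩
  have hroot : CL (∅ : Set (Form L)) A.rootForm := by
    have := CL.rootForm_of_iqc (Δ := ∅) h (Set.subset_union_of_subset_right
      (Set.union_subset CL.htq_subset_rootTheorems CL.cd_subset_rootTheorems) _)
    simpa only [CL.rootContext, Set.image_empty, Set.union_empty] using this
  obtain ⟨S, hS, i, e⟩ := exists_disjST_interpolant A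
  -- The only removal of `∼∼` from the interpolant, legitimate since disjunctions of `ST` formulas
  -- lie in `STP`.
  exact e _ (.stP hS.stp (i _ hroot))

end SFQ

theorem mainTheorem6 (L : FirstOrder.Language.{0, 0}) [Countable L.Symbols] :
    (∀ A : SFQ.IForm L,
      (∀ W ∈ SFQ.WP2.{u} L, W.IValid A) → ∀ W ∈ SFQ.WP2.{u} L, W.Valid A.star.toForm) ∧
    SFQ.IForm.star '' SFQ.HTCD L ⊆ SFQ.SFQPNegEFree L := by
  refine ⟨fun A h W hW => SFQ.Model.valid_star_of_iValid hW (h W hW), ?_⟩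
  rintro _ ⟨A, hA, rfl⟩
  exact SFQ.star_mem_sfqpNegEFree hA
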